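/- Let $f\colon\Gamma\to G$ be a homomorphism of groups such that the induced homomorphism $f_{ab}\colon\Gamma_{ab}\to G_{ab}$ of abelianizations is surjective, and let $A$ be an abelian group. A central $f$-extension of $G$ with kernel $A$ is a central extension $0\to A\to M\xrightarrow{n} G\to 1$ together with a homomorphism $\psi\colon\Gamma\to M$ such that $n\circ\psi=f$. Two such, $(M,\psi)$ and $(M',\psi')$, are equivalent if there is a homomorphism $\tau\colon M\to M'$ that induces the identity on $A$ and on $G$ and satisfies $\tau\circ\psi=\psi'$. Let $\mathrm{Ext}^{\Gamma}(G;A)$ be the set of equivalence classes, which is an abelian group under the Baer sum: the push-out along the addition $A\times A\to A$ of $M\times_G M'$ with structure map $\gamma\mapsto(\psi(\gamma),\psi'(\gamma))$. Its neutral element is the class of $A\times G$ with structure map $\gamma\mapsto(0,f(\gamma))$, and the inverse is push-out along $-1\colon A\to A$. Let $C_*(-)$ be the integral bar complex of a group and let $H_2(G,\Gamma)$ be the second homology group of the mapping cone of $C_*(f)$, that is, of the complex $C_n(G,\Gamma)=C_n(G)\oplus C_{n-1}(\Gamma)$ with differential $d(x,y)=(dx-C_{n-1}(f)(y),\,-dy)$.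 Then there is an isomorphism of abelian groups $$\mathrm{Ext}^{\Gamma}(G;A)\;\cong\;\mathrm{Hom}(H_2(G,\Gamma),A),$$ natural in $A$ (with respect to push-out of extensions along homomorphisms $A\to B$) and natural in $f$ (with respect to pull-back of extensions along commutative squares $\beta\circ f'=f\circ\alpha$, where $\alpha\colon\Gamma'\to\Gamma$, $\beta\colon G'\to G$ and $f'\colon\Gamma'\to G'$ is also surjective on abelianizations; the pull-back has middle group $M\times_G G'$ and structure map $\gamma'\mapsto(\psi(\alpha(\gamma')),f'(\gamma'))$). -/

import Mathlib

/-! ### The integral bar complex of a group and the relative group `H₂(G, Γ)` -/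

universe u v w

namespace RelSchur

open Finsupp

/-- The group `C_n(G)` of inhomogeneous integral bar chains: the free abelian group on `Gⁿ`. -/
abbrev Bar (G : Type u) (n : ℕ) : Type u := (Fin n → G) →₀ ℤ

/-- The bar differential `C_{n+1}(G) → C_n(G)`,
`[g₀|…|g_n] ↦ [g₁|…|g_n] + ∑_{j<n} (-1)^{j+1} [g₀|…|g_j g_{j+1}|…|g_n] + (-1)^{n+1} [g₀|…|g_{n-1}]`
(`Fin.contractNth n` forgets the last entry). -/
noncomputable def barD (G : Type u) [Group G] (n : ℕ) : Bar G (n + 1) →ₗ[ℤ] Bar G n :=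
  Finsupp.linearCombination ℤ fun g : Fin (n + 1) → G =>
    single (fun i => g i.succ) (1 : ℤ) +
      ∑ j : Fin (n + 1), (-1 : ℤ) ^ ((j : ℕ) + 1) • single (Fin.contractNth j (· * ·) g) (1 : ℤ)

/-- The chain map `C_n(f)` induced by a group homomorphism `f`. -/
noncomputable def barMap {G : Type u} {H : Type v} [Group G] [Group H] (f : G →* H) (n : ℕ) :
    Bar G n →ₗ[ℤ] Bar H n :=
  Finsupp.lmapDomain ℤ ℤ fun g => f ∘ g

lemma barMap_comp {G : Type*} {H : Type*} {K : Type*} [Group G] [Group H] [Group K]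
    (g : H →* K) (f : G →* H) (n : ℕ) (x : Bar G n) :
    barMap (g.comp f) n x = barMap g n (barMap f n x) := by
  simp only [barMap, Finsupp.lmapDomain_apply, ← Finsupp.mapDomain_comp]
  rfl

lemma barD_barMap {G : Type u} {H : Type v} [Group G] [Group H] (f : G →* H) (n : ℕ)
    (x : Bar G (n + 1)) : barD H n (barMap f (n + 1) x) = barMap f n (barD G n x) := by
  suffices h : (barD H n).comp (barMap f (n + 1)) = (barMap f n).comp (barD G n) from
    LinearMap.congr_fun h x
  refine Finsupp.lhom_ext' fun g => LinearMap.ext_ring ?_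
  simp only [barD, barMap, LinearMap.comp_apply, lsingle_apply, lmapDomain_apply,
    mapDomain_single, linearCombination_single, one_smul, map_add, map_sum, map_smul,
    Fin.comp_contractNth, map_mul]
  rfl

/-- `barD` is Mathlib's differential on the inhomogeneous chains of the trivial module `ℤ`
(lifted to the universe of `G`). -/
lemma barD_eq_groupHomology_d (G : Type u) [Group G] (n : ℕ) (x : Bar G (n + 1)) :
    (groupHomology.inhomogeneousChains.d (Rep.trivial (ULift.{u} ℤ) G (ULift.{u} ℤ)) n).hom
        (x.mapRange ULift.up rfl) = (barD G n x).mapRange ULift.up rfl := by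
  induction x using Finsupp.induction_linear with
  | zero => simp
  | add x y hx hy =>
    rw [Finsupp.mapRange_add (fun _ _ => rfl), map_add, hx, hy, map_add,
      Finsupp.mapRange_add (fun _ _ => rfl)]
  | single g a =>
    rw [Finsupp.mapRange_single, groupHomology.inhomogeneousChains.d_single, barD,
      linearCombination_single]
    ext k
    classical
    have hd : ∀ (p : Prop) [Decidable p] (z : ULift.{u} ℤ),
        (if p then z else 0).down = if p then z.down else 0 := fun p _ z => by split_ifs <;> rfl
    have hs : ∀ F : Fin (n + 1) → ULift.{u} ℤ, (∑ c, F c).down = ∑ c, (F c).down :=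
      fun F => map_sum (AddEquiv.ulift (α := ℤ)) F _
    simp [Finsupp.single_apply, Finset.mul_sum, hd, hs, mul_comm]
    exact Finset.sum_congr rfl fun c _ => by split_ifs <;> rfl

lemma barD_barD (G : Type u) [Group G] (n : ℕ) (x : Bar G (n + 2)) :
    barD G n (barD G (n + 1) x) = 0 := by
  have h := congrArg (fun φ => φ.hom (x.mapRange ULift.up rfl))
    (groupHomology.inhomogeneousChains.d_comp_d
      (A := Rep.trivial (ULift.{u} ℤ) G (ULift.{u} ℤ)) (n := n))
  simp only [ModuleCat.hom_comp, LinearMap.comp_apply] at h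
  rw [barD_eq_groupHomology_d, barD_eq_groupHomology_d] at h
  refine Finsupp.mapRange_injective ULift.up rfl ULift.up_injective (h.trans ?_)
  simp

section Relative

variable {Γ : Type u} {G : Type v} [Group Γ] [Group G]

/-- The differential `C_{n+2}(G, Γ) → C_{n+1}(G, Γ)` of the mapping cone of `C(f)`, where
`C_m(G, Γ) = C_m(G) ⊕ C_{m-1}(Γ)` and `d (x, y) = (d x - f y, - d y)`. -/
noncomputable def relD (f : Γ →* G) (n : ℕ) :
    (Bar G (n + 2) × Bar Γ (n + 1)) →ₗ[ℤ] (Bar G (n + 1) × Bar Γ n) :=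
  LinearMap.prod
    ((barD G (n + 1)).comp (LinearMap.fst ℤ _ _) - (barMap f (n + 1)).comp (LinearMap.snd ℤ _ _))
    (-(barD Γ n).comp (LinearMap.snd ℤ _ _))

lemma relD_apply (f : Γ →* G) (n : ℕ) (x : Bar G (n + 2)) (y : Bar Γ (n + 1)) :
    relD f n (x, y) = (barD G (n + 1) x - barMap f (n + 1) y, -barD Γ n y) := rfl

lemma relD_relD (f : Γ →* G) (n : ℕ) (z : Bar G (n + 3) × Bar Γ (n + 2)) :
    relD f n (relD f (n + 1) z) = 0 := by
  obtain ⟨x, y⟩ := z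
  simp [relD_apply, barD_barD, barD_barMap]

/-- The second relative integral homology group `H₂(G, Γ)` of `f : Γ → G`: degree two cycles of
the mapping cone modulo boundaries. -/
abbrev H2 (f : Γ →* G) : Type (max u v) :=
  LinearMap.ker (relD f 0) ⧸ (LinearMap.range (relD f 1)).submoduleOf (LinearMap.ker (relD f 0))

variable {Γ' : Type u} {G' : Type v} [Group Γ'] [Group G']

/-- The map of relative chains induced by a commutative square of group homomorphisms. -/
noncomputable def relMap (α : Γ' →* Γ) (β : G' →* G) (n : ℕ) :
    (Bar G' (n + 1) × Bar Γ' n) →ₗ[ℤ] (Bar G (n + 1) × Bar Γ n) :=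
  LinearMap.prodMap (barMap β (n + 1)) (barMap α n)

lemma relD_relMap {f : Γ →* G} {f' : Γ' →* G'} {α : Γ' →* Γ} {β : G' →* G}
    (h : β.comp f' = f.comp α) (n : ℕ) (z : Bar G' (n + 2) × Bar Γ' (n + 1)) :
    relD f n (relMap α β (n + 1) z) = relMap α β n (relD f' n z) := by
  obtain ⟨x, y⟩ := z
  simp [relMap, relD_apply, barD_barMap, ← barMap_comp, h]

lemma relMap_mem_ker {f : Γ →* G} {f' : Γ' →* G'} {α : Γ' →* Γ} {β : G' →* G}
    (h : β.comp f' = f.comp α) (z : Bar G' 2 × Bar Γ' 1) (hz : z ∈ LinearMap.ker (relD f' 0)) :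
    relMap α β 1 z ∈ LinearMap.ker (relD f 0) := by
  rw [LinearMap.mem_ker] at hz ⊢
  rw [relD_relMap h, hz, map_zero]

/-- The map `H₂(G', Γ') → H₂(G, Γ)` induced by a commutative square of group homomorphisms. -/
noncomputable def H2.map {f : Γ →* G} {f' : Γ' →* G'} {α : Γ' →* Γ} {β : G' →* G}
    (h : β.comp f' = f.comp α) : H2 f' →+ H2 f :=
  (Submodule.mapQ _ _ ((relMap α β 1).restrict (relMap_mem_ker h)) (by
    rintro ⟨z, hz⟩ ⟨t, ht⟩
    exact ⟨relMap α β 2 t, (relD_relMap h 1 t).trans (congrArg (relMap α β 1) ht)⟩)).toAddMonoidHom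

end Relative

/-! ### Central `f`-extensions -/

/-- A central `f`-extension of `G` with kernel `A`: a central extension `0 → A → M → G → 1`
together with a homomorphism `ψ : Γ → M` lifting `f`. -/
structure CentralFExt {Γ : Type u} {G : Type v} [Group Γ] [Group G] (f : Γ →* G)
    (A : Type w) [AddCommGroup A] where
  /-- the middle group (any middle group is in bijection with `A × G`, so this universe is
  large enough to contain all extensions up to isomorphism) -/
  M : Type (max v w)
  [group : Group M]
  /-- the underlying extension -/
  ext : GroupExtension (Multiplicative A) M G
  /-- the extension is central -/
  central : ext.inl.range ≤ Subgroup.center M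
  /-- the structure map -/
  ψ : Γ →* M
  /-- the structure map lifts `f` -/
  rightHom_ψ : ∀ γ, ext.rightHom (ψ γ) = f γ

attribute [instance] CentralFExt.group

namespace CentralFExt

variable {Γ : Type u} {G : Type v} [Group Γ] [Group G] {f : Γ →* G}
variable {A : Type w} [AddCommGroup A] {B : Type w} [AddCommGroup B] {C : Type w} [AddCommGroup C]
variable {D : Type w} [AddCommGroup D]

/-- The inclusion of the kernel, written on `A`. -/
def ι (E : CentralFExt f A) (a : A) : E.M := E.ext.inl (Multiplicative.ofAdd a)

/-- The projection to `G`. -/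
def π (E : CentralFExt f A) : E.M →* G := E.ext.rightHom

lemma ι_add (E : CentralFExt f A) (a b : A) : E.ι (a + b) = E.ι a * E.ι b :=
  map_mul E.ext.inl _ _

lemma ι_zero (E : CentralFExt f A) : E.ι 0 = 1 := map_one E.ext.inl

lemma ι_neg (E : CentralFExt f A) (a : A) : E.ι (-a) = (E.ι a)⁻¹ := map_inv E.ext.inl _

lemma ι_injective (E : CentralFExt f A) : Function.Injective E.ι :=
  E.ext.inl_injective.comp Multiplicative.ofAdd.injective

lemma π_ι (E : CentralFExt f A) (a : A) : E.π (E.ι a) = 1 := E.ext.rightHom_inl _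

lemma π_ψ (E : CentralFExt f A) (γ : Γ) : E.π (E.ψ γ) = f γ := E.rightHom_ψ γ

lemma π_surjective (E : CentralFExt f A) : Function.Surjective E.π := E.ext.rightHom_surjective

lemma ι_comm (E : CentralFExt f A) (a : A) (m : E.M) : E.ι a * m = m * E.ι a :=
  ((Subgroup.mem_center_iff.1 (E.central ⟨_, rfl⟩)) m).symm

lemma exists_ι (E : CentralFExt f A) {m : E.M} (h : E.π m = 1) : ∃ a, E.ι a = m := by
  have : m ∈ E.ext.inl.range := by
    rw [E.ext.range_inl_eq_ker_rightHom]; exact h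
  obtain ⟨a, rfl⟩ := this
  exact ⟨a.toAdd, rfl⟩

/-- Build a central `f`-extension from its elementwise description. -/
def ofMaps (M : Type (max v w)) [Group M] (i : Multiplicative A →* M) (p : M →* G) (ψ : Γ →* M)
    (hi : Function.Injective i) (hp : Function.Surjective p)
    (hip : ∀ a, p (i a) = 1) (hpi : ∀ m, p m = 1 → ∃ a, i a = m)
    (hc : ∀ a m, i a * m = m * i a) (hψ : ∀ γ, p (ψ γ) = f γ) : CentralFExt f A where
  M := M
  ext :=
    { inl := i
      rightHom := p
      inl_injective := hi
      range_inl_eq_ker_rightHom := by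
        ext m
        constructor
        · rintro ⟨a, rfl⟩
          exact hip a
        · exact fun h => hpi m h
      rightHom_surjective := hp }
  central := by
    rintro _ ⟨a, rfl⟩
    exact Subgroup.mem_center_iff.2 fun m => (hc a m).symm
  ψ := ψ
  rightHom_ψ := hψ

/-- A map of central `f`-extensions over a homomorphism `κ` of the kernels: it is compatible with
the inclusions of the kernels, the projections to `G` and the structure maps. -/
structure Hom (κ : A →+ B) (E : CentralFExt f A) (E' : CentralFExt f B) where
  /-- the homomorphism of the middle groups -/
  τ : E.M →* E'.M
  map_ι : ∀ a, τ (E.ι a) = E'.ι (κ a)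
  map_π : ∀ m, E'.π (τ m) = E.π m
  map_ψ : ∀ γ, τ (E.ψ γ) = E'.ψ γ

/-- Composition of maps of central `f`-extensions. -/
def Hom.comp {κ : A →+ B} {κ' : B →+ C} {E : CentralFExt f A} {E' : CentralFExt f B}
    {E'' : CentralFExt f C} (t' : Hom κ' E' E'') (t : Hom κ E E') : Hom (κ'.comp κ) E E'' where
  τ := t'.τ.comp t.τ
  map_ι a := by simp [t.map_ι, t'.map_ι]
  map_π m := by simp [t.map_π, t'.map_π]
  map_ψ γ := by simp [t.map_ψ, t'.map_ψ]

lemma Hom.bijective {E E' : CentralFExt f A} (t : Hom (AddMonoidHom.id A) E E') :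
    Function.Bijective t.τ := by
  constructor
  · rw [injective_iff_map_eq_one]
    intro m hm
    obtain ⟨a, rfl⟩ := E.exists_ι (m := m) (by rw [← t.map_π, hm, map_one])
    rw [t.map_ι, ← E'.ι_zero] at hm
    have := E'.ι_injective hm
    simp only [AddMonoidHom.id_apply] at this
    rw [this, E.ι_zero]
  · intro m'
    obtain ⟨m, hm⟩ := E.π_surjective (E'.π m')
    obtain ⟨a, ha⟩ := E'.exists_ι (m := (t.τ m)⁻¹ * m') (by
      rw [map_mul, map_inv, t.map_π, hm, inv_mul_cancel])
    refine ⟨m * E.ι a, ?_⟩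
    rw [map_mul, t.map_ι, AddMonoidHom.id_apply, ha, mul_inv_cancel_left]

/-- The inverse of a map over the identity of the kernel. -/
noncomputable def Hom.symm {E E' : CentralFExt f A} (t : Hom (AddMonoidHom.id A) E E') :
    Hom (AddMonoidHom.id A) E' E where
  τ := (MulEquiv.ofBijective t.τ t.bijective).symm.toMonoidHom
  map_ι a := (MulEquiv.symm_apply_eq _).2 (t.map_ι a).symm
  map_π m := by
    obtain ⟨m, rfl⟩ := t.bijective.2 m
    rw [t.map_π]
    exact congrArg E.π ((MulEquiv.ofBijective t.τ t.bijective).symm_apply_apply m)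
  map_ψ γ := (MulEquiv.symm_apply_eq _).2 (t.map_ψ γ).symm

/-- Two central `f`-extensions with kernel `A` are equivalent if there is a map between them which
is the identity on `A` (and on `G`); such a map is an isomorphism. -/
instance setoid (f : Γ →* G) (A : Type w) [AddCommGroup A] : Setoid (CentralFExt f A) where
  r E E' := Nonempty (Hom (AddMonoidHom.id A) E E')
  iseqv :=
    { refl := fun E => ⟨⟨MonoidHom.id _, fun _ => rfl, fun _ => rfl, fun _ => rfl⟩⟩
      symm := fun ⟨t⟩ => ⟨t.symm⟩
      trans := fun ⟨t⟩ ⟨t'⟩ => ⟨t'.comp t⟩ }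

/-! #### Push-out along a homomorphism of kernels -/

/-- The subgroup `{(κ a, -a) | a ∈ A}` of `B × M`. -/
def pushSubgroup (κ : A →+ B) (E : CentralFExt f A) : Subgroup (Multiplicative B × E.M) where
  carrier := {z | ∃ a : A, z = (Multiplicative.ofAdd (κ a), E.ι (-a))}
  one_mem' := ⟨0, by simp [E.ι_zero]; rfl⟩
  mul_mem' := by
    rintro _ _ ⟨a, rfl⟩ ⟨b, rfl⟩
    exact ⟨b + a, by simp [E.ι_add, mul_comm]⟩
  inv_mem' := by
    rintro _ ⟨a, rfl⟩
    exact ⟨-a, by simp [E.ι_neg]⟩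

instance pushSubgroup_normal (κ : A →+ B) (E : CentralFExt f A) : (E.pushSubgroup κ).Normal where
  conj_mem := by
    rintro _ ⟨a, rfl⟩ ⟨b, m⟩
    refine ⟨a, ?_⟩
    ext
    · simp
    · simp [← E.ι_comm]

/-- The push-out of a central `f`-extension along a homomorphism `κ : A → B` of kernels: the
middle group is the quotient of `B × M` by `{(κ a, -a)}`, with structure map induced by `ψ`. -/
def pushExt (κ : A →+ B) (E : CentralFExt f A) : CentralFExt f B :=
  ofMaps ((Multiplicative B × E.M) ⧸ E.pushSubgroup κ)
    ((QuotientGroup.mk' (E.pushSubgroup κ)).comp (MonoidHom.inl _ _))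
    (QuotientGroup.lift (E.pushSubgroup κ) (E.π.comp (MonoidHom.snd _ _)) (by
      rintro _ ⟨a, rfl⟩
      simp [E.π_ι]))
    ((QuotientGroup.mk' (E.pushSubgroup κ)).comp ((MonoidHom.inr _ _).comp E.ψ))
    (by
      rw [injective_iff_map_eq_one]
      intro b hb
      obtain ⟨a, ha⟩ := (QuotientGroup.eq_one_iff _).1 hb
      have h1 := congrArg Prod.fst ha
      have h2 := congrArg Prod.snd ha
      simp only [MonoidHom.inl_apply] at h1 h2
      have h3 : -a = 0 := E.ι_injective (by rw [← h2, E.ι_zero])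
      rw [h1, neg_eq_zero.1 h3, map_zero, ofAdd_zero])
    (fun g => by
      obtain ⟨m, rfl⟩ := E.π_surjective g
      exact ⟨QuotientGroup.mk (1, m), rfl⟩)
    (fun b => map_one E.π)
    (fun z hz => by
      obtain ⟨⟨b, m⟩, rfl⟩ := QuotientGroup.mk_surjective z
      obtain ⟨a, rfl⟩ := E.exists_ι (m := m) hz
      refine ⟨b * Multiplicative.ofAdd (κ a), (QuotientGroup.eq).2 ⟨-a, ?_⟩⟩
      ext
      · simp
      · simp)
    (fun b z => by
      obtain ⟨⟨b', m⟩, rfl⟩ := QuotientGroup.mk_surjective z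
      exact congrArg QuotientGroup.mk (Prod.ext (mul_comm b b') (by simp)))
    (fun γ => E.π_ψ γ)

/-- The canonical map to the push-out. -/
def toPush (κ : A →+ B) (E : CentralFExt f A) : Hom κ E (E.pushExt κ) where
  τ := (QuotientGroup.mk' (E.pushSubgroup κ)).comp (MonoidHom.inr _ _)
  map_ι a := (QuotientGroup.eq).2 ⟨a, by
    ext
    · simp
    · simp [E.ι_neg]⟩
  map_π _ := rfl
  map_ψ _ := rfl

/-- A map over `κ` identifies its target with the push-out. -/
def ofPush {κ : A →+ B} {E : CentralFExt f A} {E' : CentralFExt f B} (t : Hom κ E E') :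
    Hom (AddMonoidHom.id B) (E.pushExt κ) E' where
  τ := QuotientGroup.lift (E.pushSubgroup κ)
    { toFun := fun z => E'.ι z.1.toAdd * t.τ z.2
      map_one' := by simp [E'.ι_zero]
      map_mul' := fun z z' => by
        simp only [Prod.fst_mul, Prod.snd_mul, toAdd_mul, E'.ι_add, map_mul, mul_assoc]
        rw [← mul_assoc (t.τ z.2), ← E'.ι_comm, mul_assoc] } (by
      rintro _ ⟨a, rfl⟩
      simp [t.map_ι, ← E'.ι_add, E'.ι_zero])
  map_ι b := show E'.ι b * t.τ 1 = _ by simp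
  map_π z := by
    obtain ⟨⟨b, m⟩, rfl⟩ := QuotientGroup.mk_surjective z
    exact show E'.π (E'.ι b.toAdd * t.τ m) = E.π m by simp [E'.π_ι, t.map_π]
  map_ψ γ := show E'.ι 0 * t.τ (E.ψ γ) = _ by simp [E'.ι_zero, t.map_ψ]

/-! #### Fibre product over `G`, the trivial extension and pull-back -/

/-- The fibre product over `G` of two central `f`-extensions, a central `f`-extension with kernel
`A × B` and structure map `γ ↦ (ψ γ, ψ' γ)`. -/
def prodExt (E : CentralFExt f A) (E' : CentralFExt f B) : CentralFExt f (A × B) :=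
  ofMaps ((E.π.comp (MonoidHom.fst E.M E'.M)).eqLocus (E'.π.comp (MonoidHom.snd E.M E'.M)))
    { toFun := fun c => ⟨(E.ι c.toAdd.1, E'.ι c.toAdd.2), (E.π_ι _).trans (E'.π_ι _).symm⟩
      map_one' := Subtype.ext (Prod.ext E.ι_zero E'.ι_zero)
      map_mul' := fun _ _ => Subtype.ext (Prod.ext (E.ι_add _ _) (E'.ι_add _ _)) }
    ((E.π.comp (MonoidHom.fst E.M E'.M)).comp (Subgroup.subtype _))
    { toFun := fun γ => ⟨(E.ψ γ, E'.ψ γ), (E.π_ψ γ).trans (E'.π_ψ γ).symm⟩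
      map_one' := Subtype.ext (Prod.ext (map_one _) (map_one _))
      map_mul' := fun _ _ => Subtype.ext (Prod.ext (map_mul _ _ _) (map_mul _ _ _)) }
    (fun c c' h => by
      have h' := congrArg Subtype.val h
      exact Multiplicative.toAdd.injective (Prod.ext (E.ι_injective (congrArg Prod.fst h'))
        (E'.ι_injective (congrArg Prod.snd h'))))
    (fun g => by
      obtain ⟨m, hm⟩ := E.π_surjective g
      obtain ⟨m', hm'⟩ := E'.π_surjective g
      exact ⟨⟨(m, m'), hm.trans hm'.symm⟩, hm⟩)
    (fun c => E.π_ι _)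
    (fun ⟨⟨m, m'⟩, h⟩ hm => by
      obtain ⟨a, ha⟩ := E.exists_ι (m := m) hm
      obtain ⟨b, hb⟩ := E'.exists_ι (m := m') (Eq.trans (Eq.symm h) hm)
      exact ⟨Multiplicative.ofAdd (a, b), Subtype.ext (Prod.ext ha hb)⟩)
    (fun _ _ => Subtype.ext (Prod.ext (E.ι_comm _ _) (E'.ι_comm _ _)))
    (fun γ => E.π_ψ γ)

/-- Functoriality of the fibre product. -/
def prodHom {κ : A →+ C} {l : B →+ D} {E₁ : CentralFExt f A} {E₂ : CentralFExt f B}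
    {E₃ : CentralFExt f C} {E₄ : CentralFExt f D} (s : Hom κ E₁ E₃) (t : Hom l E₂ E₄) :
    Hom (κ.prodMap l) (E₁.prodExt E₂) (E₃.prodExt E₄) where
  τ :=
    { toFun := fun z => ⟨(s.τ z.1.1, t.τ z.1.2),
        (s.map_π _).trans (Eq.trans z.2 (t.map_π _).symm)⟩
      map_one' := Subtype.ext (Prod.ext (map_one _) (map_one _))
      map_mul' := fun _ _ => Subtype.ext (Prod.ext (map_mul _ _ _) (map_mul _ _ _)) }
  map_ι _ := Subtype.ext (Prod.ext (s.map_ι _) (t.map_ι _))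
  map_π _ := s.map_π _
  map_ψ _ := Subtype.ext (Prod.ext (s.map_ψ _) (t.map_ψ _))

/-- Two maps out of the same extension give a map to the fibre product. -/
def prodLift {κ : A →+ B} {l : A →+ C} {E : CentralFExt f A} {E₁ : CentralFExt f B}
    {E₂ : CentralFExt f C} (s : Hom κ E E₁) (t : Hom l E E₂) :
    Hom (κ.prod l) E (E₁.prodExt E₂) where
  τ :=
    { toFun := fun z => ⟨(s.τ z, t.τ z), (s.map_π _).trans (t.map_π _).symm⟩
      map_one' := Subtype.ext (Prod.ext (map_one _) (map_one _))
      map_mul' := fun _ _ => Subtype.ext (Prod.ext (map_mul _ _ _) (map_mul _ _ _)) }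
  map_ι _ := Subtype.ext (Prod.ext (s.map_ι _) (t.map_ι _))
  map_π _ := s.map_π _
  map_ψ _ := Subtype.ext (Prod.ext (s.map_ψ _) (t.map_ψ _))

/-- The first projection of the fibre product. -/
def prodFst (E : CentralFExt f A) (E' : CentralFExt f B) :
    Hom (AddMonoidHom.fst A B) (E.prodExt E') E where
  τ := (MonoidHom.fst E.M E'.M).comp (Subgroup.subtype _)
  map_ι _ := rfl
  map_π _ := rfl
  map_ψ _ := rfl

/-- The second projection of the fibre product. -/
def prodSnd (E : CentralFExt f A) (E' : CentralFExt f B) :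
    Hom (AddMonoidHom.snd A B) (E.prodExt E') E' where
  τ := (MonoidHom.snd E.M E'.M).comp (Subgroup.subtype _)
  map_ι _ := rfl
  map_π z := Eq.symm z.2
  map_ψ _ := rfl

/-- The trivial central `f`-extension `A × G`, with structure map `γ ↦ (0, f γ)`. -/
def trivialExt (f : Γ →* G) (A : Type w) [AddCommGroup A] : CentralFExt f A :=
  ofMaps (Multiplicative A × G) (MonoidHom.inl _ _) (MonoidHom.snd _ _)
    ((MonoidHom.inr _ _).comp f)
    (fun _ _ h => congrArg Prod.fst h) (fun g => ⟨(1, g), rfl⟩) (fun _ => rfl)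
    (fun ⟨a, _⟩ h => ⟨a, Prod.ext rfl (Eq.symm h)⟩)
    (fun a m => Prod.ext (mul_comm _ _) (by simp)) (fun _ => rfl)

/-- The map `E → A × G` over the zero homomorphism. -/
def toTrivial (B : Type w) [AddCommGroup B] (E : CentralFExt f A) :
    Hom (0 : A →+ B) E (trivialExt f B) where
  τ := (MonoidHom.inr _ _).comp E.π
  map_ι a := Prod.ext rfl (E.π_ι a)
  map_π _ := rfl
  map_ψ γ := Prod.ext rfl (E.π_ψ γ)

/-- The pull-back of a central `f`-extension along a commutative square `β ∘ f' = f ∘ α`: the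
middle group is `M ×_G G'`, with structure map `γ' ↦ (ψ (α γ'), f' γ')`. -/
def pullExt {Γ' : Type u} {G' : Type v} [Group Γ'] [Group G'] {f' : Γ' →* G'} {α : Γ' →* Γ}
    {β : G' →* G} (h : β.comp f' = f.comp α) (E : CentralFExt f A) : CentralFExt f' A :=
  ofMaps ((E.π.comp (MonoidHom.fst E.M G')).eqLocus (β.comp (MonoidHom.snd E.M G')))
    { toFun := fun a => ⟨(E.ι a.toAdd, 1), (E.π_ι _).trans (map_one β).symm⟩
      map_one' := Subtype.ext (Prod.ext E.ι_zero rfl)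
      map_mul' := fun _ _ => Subtype.ext (Prod.ext (E.ι_add _ _) (mul_one 1).symm) }
    ((MonoidHom.snd E.M G').comp (Subgroup.subtype _))
    { toFun := fun γ => ⟨(E.ψ (α γ), f' γ), (E.π_ψ _).trans (DFunLike.congr_fun h γ).symm⟩
      map_one' := Subtype.ext (Prod.ext (by simp) (map_one _))
      map_mul' := fun _ _ => Subtype.ext (Prod.ext (by simp) (map_mul _ _ _)) }
    (fun _ _ h => Multiplicative.toAdd.injective
      (E.ι_injective (congrArg Prod.fst (congrArg Subtype.val h))))
    (fun g => by
      obtain ⟨m, hm⟩ := E.π_surjective (β g)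
      exact ⟨⟨(m, g), hm⟩, rfl⟩)
    (fun _ => rfl)
    (fun ⟨⟨m, g⟩, h⟩ hg => by
      obtain rfl : g = 1 := hg
      obtain ⟨a, ha⟩ := E.exists_ι (m := m) (Eq.trans h (map_one β))
      exact ⟨Multiplicative.ofAdd a, Subtype.ext (Prod.ext ha rfl)⟩)
    (fun _ z => Subtype.ext (Prod.ext (E.ι_comm _ _) (by simp)))
    (fun _ => rfl)

/-- Functoriality of the pull-back. -/
def pullHom {Γ' : Type u} {G' : Type v} [Group Γ'] [Group G'] {f' : Γ' →* G'} {α : Γ' →* Γ}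
    {β : G' →* G} (h : β.comp f' = f.comp α) {κ : A →+ B} {E : CentralFExt f A}
    {E' : CentralFExt f B} (t : Hom κ E E') : Hom κ (E.pullExt h) (E'.pullExt h) where
  τ :=
    { toFun := fun z => ⟨(t.τ z.1.1, z.1.2), (t.map_π _).trans z.2⟩
      map_one' := Subtype.ext (Prod.ext (map_one _) rfl)
      map_mul' := fun _ _ => Subtype.ext (Prod.ext (map_mul _ _ _) rfl) }
  map_ι _ := Subtype.ext (Prod.ext (t.map_ι _) rfl)
  map_π _ := rfl
  map_ψ _ := Subtype.ext (Prod.ext (t.map_ψ _) rfl)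

end CentralFExt

/-! ### The group `Ext^Γ(G; A)` -/

/-- The set `Ext^Γ(G; A)` of equivalence classes of central `f`-extensions with kernel `A`. -/
def Ext {Γ : Type u} {G : Type v} [Group Γ] [Group G] (f : Γ →* G)
    (A : Type w) [AddCommGroup A] : Type (max u (v + 1) (w + 1)) :=
  Quotient (CentralFExt.setoid f A)

namespace Ext

open CentralFExt

variable {Γ : Type u} {G : Type v} [Group Γ] [Group G] {f : Γ →* G}
variable {A : Type w} [AddCommGroup A] {B : Type w} [AddCommGroup B] {C : Type w} [AddCommGroup C]

/-- The class of a central `f`-extension. -/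
def mk (E : CentralFExt f A) : Ext f A := Quotient.mk _ E

lemma mk_eq {E E' : CentralFExt f A} (t : CentralFExt.Hom (AddMonoidHom.id A) E E') :
    mk E = mk E' := Quotient.sound ⟨t⟩

/-- Push-out of classes along a homomorphism of kernels. -/
def push (κ : A →+ B) : Ext f A → Ext f B :=
  Quotient.map (pushExt κ) fun _ E' ⟨t⟩ => ⟨ofPush ((E'.toPush κ).comp t)⟩

lemma push_mk_eq {κ : A →+ B} {E : CentralFExt f A} {E' : CentralFExt f B}
    (t : CentralFExt.Hom κ E E') : push κ (mk E) = mk E' := mk_eq (ofPush t)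

/-- Pull-back of classes along a commutative square `β ∘ f' = f ∘ α`. -/
def pull {Γ' : Type u} {G' : Type v} [Group Γ'] [Group G'] {f' : Γ' →* G'} {α : Γ' →* Γ}
    {β : G' →* G} (h : β.comp f' = f.comp α) : Ext f A → Ext f' A :=
  Quotient.map (pullExt h) fun _ _ ⟨t⟩ => ⟨pullHom h t⟩

/-- The addition homomorphism `A × A → A`. -/
def addHom (A : Type w) [AddCommGroup A] : A × A →+ A := AddMonoidHom.fst A A + AddMonoidHom.snd A A

/-- The Baer sum: the push-out along `A × A → A` of the fibre product over `G`. -/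
instance : Add (Ext f A) where
  add := Quotient.map₂ (fun E E' => (E.prodExt E').pushExt (addHom A))
    fun _ E₁ ⟨s⟩ _ E₂ ⟨t⟩ => ⟨ofPush (((E₁.prodExt E₂).toPush (addHom A)).comp (prodHom s t))⟩

/-- The neutral element is the class of `A × G` with structure map `γ ↦ (0, f γ)`. -/
instance : Zero (Ext f A) where
  zero := mk (trivialExt f A)

/-- The inverse is the push-out along `-1 : A → A`. -/
instance : Neg (Ext f A) where
  neg := push (-AddMonoidHom.id A)

lemma mk_add_mk (E E' : CentralFExt f A) :
    mk E + mk E' = push (addHom A) (mk (E.prodExt E')) := rfl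

/-- A fibre product maps to a representative of the Baer sum. -/
def toSum (E E' : CentralFExt f A) :
    CentralFExt.Hom (addHom A) (E.prodExt E') ((E.prodExt E').pushExt (addHom A)) :=
  (E.prodExt E').toPush (addHom A)

protected lemma add_assoc : ∀ x y z : Ext f A, x + y + z = x + (y + z) := by
  rintro ⟨E₁⟩ ⟨E₂⟩ ⟨E₃⟩
  have s := (toSum ((E₁.prodExt E₂).pushExt (addHom A)) E₃).comp
    (prodHom (toSum E₁ E₂) (⟨MonoidHom.id _, fun _ => rfl, fun _ => rfl, fun _ => rfl⟩ :
      CentralFExt.Hom (AddMonoidHom.id A) E₃ E₃))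
  have t := (toSum E₁ ((E₂.prodExt E₃).pushExt (addHom A))).comp
    (prodLift ((prodFst E₁ E₂).comp (prodFst (E₁.prodExt E₂) E₃))
      ((toSum E₂ E₃).comp (prodLift ((prodSnd E₁ E₂).comp (prodFst (E₁.prodExt E₂) E₃))
        (prodSnd (E₁.prodExt E₂) E₃))))
  refine (push_mk_eq s).symm.trans (Eq.trans ?_ (push_mk_eq t))
  congr 1
  ext x
  simp [addHom, add_assoc]

protected lemma add_comm : ∀ x y : Ext f A, x + y = y + x := by
  rintro ⟨E⟩ ⟨E'⟩
  have s := (toSum E' E).comp (prodLift (prodSnd E E') (prodFst E E'))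
  refine Eq.trans ?_ (push_mk_eq s)
  refine (mk_add_mk E E').trans ?_
  congr 1
  ext x
  simp [addHom, add_comm]

protected lemma zero_add : ∀ x : Ext f A, 0 + x = x := by
  rintro ⟨E⟩
  refine push_mk_eq (κ := addHom A) (E := (trivialExt f A).prodExt E) (E' := E)
    ⟨{ toFun := fun z => E.ι (Multiplicative.toAdd (α := A) z.1.1.1) * z.1.2
       map_one' := ?_
       map_mul' := ?_ }, ?_, ?_, ?_⟩
  · exact (congrArg (· * (1 : E.M)) E.ι_zero).trans (one_mul _)
  · rintro ⟨⟨⟨a, g⟩, m⟩, h⟩ ⟨⟨⟨a', g'⟩, m'⟩, h'⟩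
    change E.ι (a.toAdd + a'.toAdd) * (m * m') = E.ι a.toAdd * m * (E.ι a'.toAdd * m')
    rw [E.ι_add, mul_assoc, mul_assoc, ← mul_assoc m, ← E.ι_comm, mul_assoc]
  · rintro ⟨a, a'⟩
    exact (E.ι_add a a').symm
  · rintro ⟨⟨⟨a, g⟩, m⟩, h⟩
    change E.π (E.ι a.toAdd * m) = g
    rw [map_mul, E.π_ι, one_mul]
    exact Eq.symm h
  · intro γ
    exact (congrArg (· * E.ψ γ) E.ι_zero).trans (one_mul _)

protected lemma neg_add_cancel : ∀ x : Ext f A, -x + x = 0 := by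
  rintro ⟨E⟩
  have s := (toSum (E.pushExt (-AddMonoidHom.id A)) E).comp
    (prodLift (E.toPush (-AddMonoidHom.id A))
      (⟨MonoidHom.id _, fun _ => rfl, fun _ => rfl, fun _ => rfl⟩ :
        CentralFExt.Hom (AddMonoidHom.id A) E E))
  refine (push_mk_eq s).symm.trans (Eq.trans ?_ (push_mk_eq (toTrivial A E)))
  congr 1
  ext
  simp [addHom]

/-- The Baer sum makes `Ext^Γ(G; A)` an abelian group. -/
instance : AddCommGroup (Ext f A) where
  add_assoc := Ext.add_assoc
  zero_add := Ext.zero_add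
  add_zero x := (Ext.add_comm x 0).trans (Ext.zero_add x)
  nsmul := nsmulRec
  zsmul := zsmulRec
  neg_add_cancel := Ext.neg_add_cancel
  add_comm := Ext.add_comm

end Ext

end RelSchur

namespace RelSchur

open Finsupp

/-! A set-theoretic section `s` of a central `f`-extension has two defects, both with values in `A`:
the factor set comparing `s g * s h` with `s (g * h)`, and the difference between `ψ γ` and `s (f
γ)`. Together they form a linear map `φ` on `C_2(G, Γ)`. Associativity of `M` and multiplicativity
of `ψ` say exactly that `φ` is a cocycle (`IsCochain.apply_relD`); changing `s` adds a coboundary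
(`IsCochain.twist`), so the restriction of `φ` to cycles depends only on the class of the extension.
This gives the map to `Hom(H_2(G, Γ), A)`. Push-out, pull-back and fibre product act on cochains in
the evident way, which yields naturality and additivity.

Bijectivity is the universal coefficient argument: the obstruction `Ext(H_1(G, Γ), A)` vanishes
because `H_1(G, Γ)` is the cokernel of `f_ab`. Concretely, the boundary onto `C_1(G)` has a linear
section `σ` (`boundary_exists_section`), so `z ↦ z - σ (boundary z)` retracts chains onto cycles. A
cocycle vanishing on cycles is then a coboundary, and every homomorphism on `H_2` extends to a
cocycle, which the twisted product on `A × G` realizes. -/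

/-! ### Bar complex in low degrees -/

lemma barD_zero (G : Type u) [Group G] : barD G 0 = 0 := by
  refine Finsupp.lhom_ext' fun g => LinearMap.ext_ring ?_
  simp [barD, Subsingleton.elim (fun i : Fin 0 => g i.succ) (Fin.contractNth 0 (· * ·) g)]

lemma barD_one_single {G : Type u} [Group G] (g h : G) :
    barD G 1 (single ![g, h] 1) = single ![h] 1 - single ![g * h] 1 + single ![g] 1 := by
  have h1 : (fun i : Fin 1 => ![g, h] i.succ) = ![h] := by ext i; fin_cases i; rfl
  have h2 : Fin.contractNth (0 : Fin 2) (· * ·) ![g, h] = ![g * h] := by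
    ext i; fin_cases i; rfl
  have h3 : Fin.contractNth (1 : Fin 2) (· * ·) ![g, h] = ![g] := by
    ext i; fin_cases i; rfl
  simp only [barD, linearCombination_single, Fin.sum_univ_succ, h1]
  simp [h2, h3]
  abel

lemma barD_two_single {G : Type u} [Group G] (g h k : G) :
    barD G 2 (single ![g, h, k] 1) =
      single ![h, k] 1 - single ![g * h, k] 1 + single ![g, h * k] 1 - single ![g, h] 1 := by
  have h1 : (fun i : Fin 2 => ![g, h, k] i.succ) = ![h, k] := by ext i; fin_cases i <;> rfl
  have h2 : Fin.contractNth (0 : Fin 3) (· * ·) ![g, h, k] = ![g * h, k] := by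
    ext i; fin_cases i <;> rfl
  have h3 : Fin.contractNth (1 : Fin 3) (· * ·) ![g, h, k] = ![g, h * k] := by
    ext i; fin_cases i <;> rfl
  have h4 : Fin.contractNth (2 : Fin 3) (· * ·) ![g, h, k] = ![g, h] := by
    ext i; fin_cases i <;> rfl
  rw [barD, linearCombination_single, h1]
  erw [Fin.sum_univ_three]
  simp [h2, h3, h4]
  abel

lemma barMap_single {G : Type u} {H : Type v} [Group G] [Group H] (f : G →* H) {n : ℕ}
    (g : Fin n → G) (a : ℤ) : barMap f n (single g a) = single (f ∘ g) a := by
  simp [barMap]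

lemma barMap_single_one {G : Type u} {H : Type v} [Group G] [Group H] (f : G →* H)
    (g : G) (a : ℤ) : barMap f 1 (single ![g] a) = single ![f g] a := by
  rw [barMap_single]
  congr 1
  ext i; fin_cases i; rfl

lemma barMap_single_two {G : Type u} {H : Type v} [Group G] [Group H] (f : G →* H)
    (g h : G) (a : ℤ) : barMap f 2 (single ![g, h] a) = single ![f g, f h] a := by
  rw [barMap_single]
  congr 1
  ext i; fin_cases i <;> rfl

lemma bar_one_hom_ext {G : Type u} {A : Type w} [AddCommGroup A] {φ φ' : Bar G 1 →ₗ[ℤ] A}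
    (h : ∀ g, φ (single ![g] 1) = φ' (single ![g] 1)) : φ = φ' := by
  refine Finsupp.lhom_ext' fun g => LinearMap.ext_ring ?_
  have hg : ![g 0] = g := by ext i; fin_cases i; rfl
  rw [← hg]
  exact h _

lemma bar_two_hom_ext {G : Type u} {A : Type w} [AddCommGroup A] {φ φ' : Bar G 2 →ₗ[ℤ] A}
    (h : ∀ g k, φ (single ![g, k] 1) = φ' (single ![g, k] 1)) : φ = φ' := by
  refine Finsupp.lhom_ext' fun g => LinearMap.ext_ring ?_
  have hg : ![g 0, g 1] = g := by ext i; fin_cases i <;> rfl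
  rw [← hg]
  exact h _ _

lemma bar_three_hom_ext {G : Type u} {A : Type w} [AddCommGroup A] {φ φ' : Bar G 3 →ₗ[ℤ] A}
    (h : ∀ g k l, φ (single ![g, k, l] 1) = φ' (single ![g, k, l] 1)) : φ = φ' := by
  refine Finsupp.lhom_ext' fun g => LinearMap.ext_ring ?_
  have hg : ![g 0, g 1, g 2] = g := by ext i; fin_cases i <;> rfl
  rw [← hg]
  exact h _ _ _

/-! ### The boundary onto `C_1(G)` and its splitting -/

section Boundary

variable {Γ : Type u} {G : Type v} [Group Γ] [Group G] (f : Γ →* G)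

/-- The component `C_2(G, Γ) → C_1(G)` of the differential of the mapping cone. -/
noncomputable def boundary : (Bar G 2 × Bar Γ 1) →ₗ[ℤ] Bar G 1 :=
  (LinearMap.fst ℤ _ _).comp (relD f 0)

/-- The discarded component of `relD f 0` is `-barD Γ 0`, which is zero by `barD_zero`. -/
lemma boundary_eq_zero_iff {z : Bar G 2 × Bar Γ 1} :
    boundary f z = 0 ↔ z ∈ LinearMap.ker (relD f 0) := by
  obtain ⟨x, y⟩ := z
  simp [boundary, relD_apply, barD_zero]

lemma boundary_inl_single (g h : G) : boundary f (single ![g, h] 1, 0) =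
    single ![h] 1 - single ![g * h] 1 + single ![g] 1 := by
  simp [boundary, relD_apply, barD_one_single]

lemma boundary_inr_single (γ : Γ) : boundary f (0, single ![γ] 1) = -single ![f γ] 1 := by
  simp [boundary, relD_apply, barMap_single_one]

lemma relD_inl_single (g h k : G) : relD f 1 (single ![g, h, k] 1, 0) =
    ((single ![h, k] 1 - single ![g * h, k] 1 + single ![g, h * k] 1 - single ![g, h] 1 :
      Bar G 2), (0 : Bar Γ 1)) := by
  refine (relD_apply f 1 _ _).trans (Prod.ext ?_ ?_)
  · rw [map_zero, sub_zero]
    exact barD_two_single g h k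
  · exact (congrArg Neg.neg (map_zero (barD Γ 1))).trans neg_zero

lemma relD_inr_single (γ δ : Γ) : relD f 1 (0, single ![γ, δ] 1) =
    (-(single ![f γ, f δ] 1 : Bar G 2),
      -(single ![δ] 1 - single ![γ * δ] 1 + single ![γ] 1 : Bar Γ 1)) := by
  refine (relD_apply f 1 _ _).trans (Prod.ext ?_ ?_)
  · rw [map_zero, zero_sub]
    exact congrArg Neg.neg (barMap_single_two f γ δ 1)
  · exact congrArg Neg.neg (barD_one_single γ δ)

/-- Surjectivity on abelianizations amounts to `H_1(G, Γ) = 0`. -/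
lemma boundary_surjective (hf : Function.Surjective (Abelianization.map f)) :
    Function.Surjective (boundary f) := by
  rw [← LinearMap.range_eq_top, ← Submodule.ker_mkQ (LinearMap.range (boundary f)),
    LinearMap.ker_eq_top]
  refine bar_one_hom_ext fun g => ?_
  -- In the cokernel, the boundary of `[g|h]` makes `g ↦ [g]` additive, and the boundary of `[γ]`
  -- kills `[f γ]`.
  set q := (LinearMap.range (boundary f)).mkQ
  have hq : ∀ z, q (boundary f z) = 0 := fun z =>
    (Submodule.Quotient.mk_eq_zero _).2 ⟨z, rfl⟩
  have hmul : ∀ g h : G, q (single ![g * h] 1) = q (single ![g] 1) + q (single ![h] 1) := by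
    intro g h
    have := hq (single ![g, h] 1, 0)
    rw [boundary_inl_single, map_add, map_sub] at this
    rw [eq_comm, ← sub_eq_zero, ← this]
    abel
  let θ : G →* Multiplicative (Bar G 1 ⧸ LinearMap.range (boundary f)) :=
    MonoidHom.mk' (fun g => Multiplicative.ofAdd (q (single ![g] 1))) fun g h => hmul g h
  -- The target of `θ` is abelian, so `θ g` depends only on the class of `g` in `G_ab`, which is
  -- also the class of some `f γ`.
  obtain ⟨x, hx⟩ := hf (Abelianization.of g)
  obtain ⟨γ, rfl⟩ := QuotientGroup.mk_surjective x
  have h1 : Abelianization.lift θ (Abelianization.map f (Abelianization.of γ)) = θ g := by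
    rw [← Abelianization.lift_apply_of θ g, ← hx]
    rfl
  rw [Abelianization.map_of, Abelianization.lift_apply_of] at h1
  have h2 := hq (0, single ![γ] 1)
  rw [boundary_inr_single, map_neg, neg_eq_zero] at h2
  exact (congrArg Multiplicative.toAdd h1).symm.trans h2

/-- `Bar G 1` is free, so a surjection onto it splits. Both injectivity and surjectivity of the
comparison map rest on this splitting. -/
lemma boundary_exists_section (hf : Function.Surjective (Abelianization.map f)) :
    ∃ σ : Bar G 1 →ₗ[ℤ] Bar G 2 × Bar Γ 1, ∀ x, boundary f (σ x) = x := by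
  obtain ⟨σ, hσ⟩ := (boundary f).exists_rightInverse_of_surjective
    (LinearMap.range_eq_top.2 (boundary_surjective f hf))
  exact ⟨σ, LinearMap.congr_fun hσ⟩

end Boundary

/-! ### Relative cochains attached to extensions -/

namespace CentralFExt

variable {Γ : Type u} {G : Type v} [Group Γ] [Group G] {f : Γ →* G}
variable {A : Type w} [AddCommGroup A] {B : Type w} [AddCommGroup B]

/-- The relative cochain `φ` measures the failure of the set-theoretic section `s` to be a
homomorphism compatible with the structure map. -/
structure IsCochain (E : CentralFExt f A) (s : G → E.M) (φ : (Bar G 2 × Bar Γ 1) →ₗ[ℤ] A) :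
    Prop where
  π_section : ∀ g, E.π (s g) = g
  section_mul : ∀ g h, s g * s h = E.ι (φ (single ![g, h] 1, 0)) * s (g * h)
  ψ_eq : ∀ γ, E.ψ γ = E.ι (φ (0, single ![γ] 1)) * s (f γ)

lemma exists_ι_mul (E : CentralFExt f A) {m m' : E.M} (h : E.π m = E.π m') :
    ∃ a, m = E.ι a * m' := by
  obtain ⟨a, ha⟩ := E.exists_ι (m := m * m'⁻¹) (by rw [map_mul, map_inv, h, mul_inv_cancel])
  exact ⟨a, by rw [ha, inv_mul_cancel_right]⟩

lemma exists_isCochain (E : CentralFExt f A) : ∃ s φ, E.IsCochain s φ := by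
  choose s hs using E.π_surjective
  have h1 : ∀ g h, ∃ a, s g * s h = E.ι a * s (g * h) := fun g h =>
    E.exists_ι_mul (by simp only [map_mul, hs])
  have h2 : ∀ γ, ∃ a, E.ψ γ = E.ι a * s (f γ) := fun γ =>
    E.exists_ι_mul (by rw [E.π_ψ, hs])
  choose c hc using h1
  choose b hb using h2
  refine ⟨s, LinearMap.coprod (linearCombination ℤ fun g => c (g 0) (g 1))
    (linearCombination ℤ fun γ => b (γ 0)), hs, fun g h => ?_, fun γ => ?_⟩
  · simpa using hc g h
  · simpa using hb γ

namespace IsCochain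

variable {E : CentralFExt f A} {s : G → E.M} {φ : (Bar G 2 × Bar Γ 1) →ₗ[ℤ] A}

/-- On generators from `G³` this is associativity of `s g * s k * s l`; on generators from `Γ²` it
is `ψ (γ * δ) = ψ γ * ψ δ`. -/
lemma apply_relD (h : E.IsCochain s φ) (z : Bar G 3 × Bar Γ 2) : φ (relD f 1 z) = 0 := by
  suffices H : φ.comp (relD f 1) = 0 from LinearMap.congr_fun H z
  -- Writing `φ (x, 0)` as a linear map in `x` lets `map_add` and `map_sub` act on the first
  -- coordinate alone; likewise for the second.
  have hx : ∀ x : Bar G 2, φ (x, 0) = φ.comp (LinearMap.inl ℤ _ _) x := fun _ => rfl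
  have hy : ∀ y : Bar Γ 1, φ (0, y) = φ.comp (LinearMap.inr ℤ _ _) y := fun _ => rfl
  refine LinearMap.prod_ext (bar_three_hom_ext fun g k l => ?_) (bar_two_hom_ext fun γ δ => ?_)
  · have key : E.ι (φ (single ![g, k] 1, 0) + φ (single ![g * k, l] 1, 0)) =
        E.ι (φ (single ![k, l] 1, 0) + φ (single ![g, k * l] 1, 0)) := by
      refine mul_right_cancel (b := s (g * k * l)) ?_
      have hl := h.section_mul (g * k) l
      have hr := h.section_mul g (k * l)
      rw [← mul_assoc] at hr
      simp only [E.ι_add, mul_assoc (E.ι _)]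
      rw [← hl, ← hr, ← mul_assoc, ← h.section_mul g k, ← mul_assoc (E.ι _) (s g),
        E.ι_comm _ (s g), mul_assoc (s g) (E.ι _), ← h.section_mul k l, mul_assoc]
    have key := E.ι_injective key
    simp only [LinearMap.comp_apply, LinearMap.inl_apply, relD_inl_single, LinearMap.zero_apply]
    simp only [hx, map_add, map_sub] at key ⊢
    rw [← sub_eq_zero] at key
    rw [← neg_eq_zero, ← key]
    abel
  · have key : E.ι (φ (0, single ![γ * δ] 1)) = E.ι (φ (0, single ![γ] 1) +
        φ (0, single ![δ] 1) + φ (single ![f γ, f δ] 1, 0)) := by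
      refine mul_right_cancel (b := s (f γ * f δ)) ?_
      rw [E.ι_add, mul_assoc, ← h.section_mul, ← map_mul, ← h.ψ_eq, map_mul, h.ψ_eq γ, h.ψ_eq δ,
        E.ι_add, mul_assoc, ← mul_assoc (s (f γ)), ← E.ι_comm]
      simp only [mul_assoc]
    have key := E.ι_injective key
    have split : ∀ (x : Bar G 2) (y : Bar Γ 1), φ (x, y) = φ (x, 0) + φ (0, y) := fun x y => by
      rw [← map_add]; simp
    simp only [LinearMap.comp_apply, LinearMap.inr_apply, relD_inr_single, LinearMap.zero_apply]
    rw [split]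
    simp only [hx, hy, map_neg, map_add, map_sub] at key ⊢
    rw [key]
    abel

lemma map (h : E.IsCochain s φ) {κ : A →+ B} {E' : CentralFExt f B} (t : Hom κ E E') :
    E'.IsCochain (t.τ ∘ s) (κ.toIntLinearMap.comp φ) where
  π_section g := (t.map_π _).trans (h.π_section g)
  section_mul g k := by
    simp only [Function.comp_apply, ← map_mul, h.section_mul g k]
    rw [map_mul, t.map_ι]
    rfl
  ψ_eq γ := by
    rw [← t.map_ψ, h.ψ_eq, map_mul, t.map_ι]
    rfl

/-- The effect on cochains of a change of the section. -/
lemma twist (h : E.IsCochain s φ) (t : Bar G 1 →ₗ[ℤ] A) :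
    E.IsCochain (fun g => E.ι (t (single ![g] 1)) * s g) (φ + t.comp (boundary f)) where
  π_section g := by rw [map_mul, E.π_ι, one_mul, h.π_section]
  section_mul g k := by
    simp only [LinearMap.add_apply, LinearMap.comp_apply, boundary_inl_single, map_add, map_sub]
    rw [mul_assoc, ← mul_assoc (s g), ← E.ι_comm, mul_assoc, h.section_mul]
    simp only [← mul_assoc, ← E.ι_add]
    congr 2
    abel
  ψ_eq γ := by
    simp only [LinearMap.add_apply, LinearMap.comp_apply, boundary_inr_single, map_neg]
    rw [← mul_assoc, ← E.ι_add, neg_add_cancel_right, h.ψ_eq]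

lemma unique (h : E.IsCochain s φ) {φ' : (Bar G 2 × Bar Γ 1) →ₗ[ℤ] A}
    (h' : E.IsCochain s φ') : φ = φ' := by
  refine LinearMap.prod_ext (bar_two_hom_ext fun g k => ?_) (bar_one_hom_ext fun γ => ?_)
  · exact E.ι_injective (mul_right_cancel ((h.section_mul g k).symm.trans (h'.section_mul g k)))
  · exact E.ι_injective (mul_right_cancel ((h.ψ_eq γ).symm.trans (h'.ψ_eq γ)))

/-- Two sections differ by a function `t : G → A`, so the cochains differ by `t` composed with
`boundary f`, which vanishes on cycles. -/
lemma eq_on_ker (h : E.IsCochain s φ) {s' : G → E.M} {φ' : (Bar G 2 × Bar Γ 1) →ₗ[ℤ] A}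
    (h' : E.IsCochain s' φ') {z : Bar G 2 × Bar Γ 1} (hz : z ∈ LinearMap.ker (relD f 0)) :
    φ z = φ' z := by
  have h1 : ∀ g, ∃ a, s' g = E.ι a * s g := fun g =>
    E.exists_ι_mul (by rw [h.π_section, h'.π_section])
  choose t ht using h1
  obtain rfl := funext ht
  have h2 := h.twist (linearCombination ℤ fun g => t (g 0))
  rw [← h2.unique (φ' := φ') (by simpa using h')]
  simp [(boundary_eq_zero_iff f).2 hz]

lemma pull {Γ' : Type u} {G' : Type v} [Group Γ'] [Group G'] {f' : Γ' →* G'} {α : Γ' →* Γ}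
    {β : G' →* G} (hsq : β.comp f' = f.comp α) (h : E.IsCochain s φ) :
    (E.pullExt hsq).IsCochain (fun g => ⟨(s (β g), g), h.π_section _⟩)
      (φ.comp (relMap α β 1)) where
  π_section g := rfl
  section_mul g k := Subtype.ext (Prod.ext (by
    have := h.section_mul (β g) (β k)
    rw [← map_mul] at this
    refine this.trans ?_
    simp [relMap, barMap_single_two]
    rfl) (one_mul _).symm)
  ψ_eq γ := Subtype.ext (Prod.ext (by
    have := h.ψ_eq (α γ)
    rw [← show β (f' γ) = f (α γ) from DFunLike.congr_fun hsq γ] at this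
    refine this.trans ?_
    simp [relMap, barMap_single_one]
    rfl) (one_mul _).symm)

lemma prod (h : E.IsCochain s φ) {E' : CentralFExt f B} {s' : G → E'.M}
    {φ' : (Bar G 2 × Bar Γ 1) →ₗ[ℤ] B} (h' : E'.IsCochain s' φ') :
    (E.prodExt E').IsCochain
      (fun g => ⟨(s g, s' g), (h.π_section g).trans (h'.π_section g).symm⟩) (φ.prod φ') where
  π_section g := h.π_section g
  section_mul g k := Subtype.ext (Prod.ext (h.section_mul g k) (h'.section_mul g k))
  ψ_eq γ := Subtype.ext (Prod.ext (h.ψ_eq γ) (h'.ψ_eq γ))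

/-- The homomorphism on relative homology induced by a cochain. -/
noncomputable def homologyHom (h : E.IsCochain s φ) : H2 f →+ A :=
  (Submodule.liftQ _ (φ.comp (LinearMap.ker (relD f 0)).subtype) (by
    rintro ⟨z, hz⟩ ⟨t, ht⟩
    exact (congrArg φ ht).symm.trans (h.apply_relD t))).toAddMonoidHom

lemma homologyHom_eq_iff (h : E.IsCochain s φ) {ℓ : H2 f →+ A} :
    h.homologyHom = ℓ ↔ ∀ z : LinearMap.ker (relD f 0), φ z = ℓ (Submodule.Quotient.mk z) := by
  refine ⟨?_, fun H => AddMonoidHom.ext fun z => ?_⟩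
  · rintro rfl z
    rfl
  · obtain ⟨z, rfl⟩ := Submodule.Quotient.mk_surjective _ z
    exact H z

/-- A vanishing cochain exhibits its section as a splitting. -/
def ofTrivial (h : E.IsCochain s 0) : Hom (AddMonoidHom.id A) (trivialExt f A) E where
  τ := MonoidHom.mk' (fun z : Multiplicative A × G => E.ι z.1.toAdd * s z.2) fun z z' => by
    have hs : s (z.2 * z'.2) = s z.2 * s z'.2 := by
      rw [h.section_mul, LinearMap.zero_apply, E.ι_zero, one_mul]
    change E.ι (z.1.toAdd + z'.1.toAdd) * s (z.2 * z'.2) = _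
    simp only [E.ι_add, hs, mul_assoc]
    rw [← mul_assoc (s z.2), ← E.ι_comm, mul_assoc]
  map_ι a := by
    -- The section is not assumed normalized; here it is multiplicative, so `s 1` is idempotent.
    have hs : s 1 = 1 := by
      have := h.section_mul 1 1
      rw [LinearMap.zero_apply, E.ι_zero, one_mul, mul_one] at this
      exact mul_eq_left.1 this
    exact show E.ι a * s 1 = E.ι a by rw [hs, mul_one]
  map_π z := show E.π (E.ι z.1.toAdd * s z.2) = z.2 by rw [map_mul, E.π_ι, one_mul, h.π_section]
  map_ψ γ := by
    rw [h.ψ_eq]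
    rfl

end IsCochain

end CentralFExt

/-! ### The extension defined by a cocycle -/

/-- The set `A × G`, carrying the group structure twisted by a cocycle. -/
@[ext]
structure TwistedProd {G : Type v} [Group G] {A : Type w} [AddCommGroup A] (c : G → G → A) :
    Type (max v w) where
  /-- the component in the kernel -/
  fst : A
  /-- the component in the quotient -/
  snd : G

namespace TwistedProd

variable {G : Type v} [Group G] {A : Type w} [AddCommGroup A] {c : G → G → A}

instance : Mul (TwistedProd c) := ⟨fun x y => ⟨x.fst + y.fst + c x.snd y.snd, x.snd * y.snd⟩⟩

/-- The cocycle is not normalized, hence the correction by `c 1 1` in the unit and in the inverse.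
-/
instance : One (TwistedProd c) := ⟨⟨-c 1 1, 1⟩⟩

instance : Inv (TwistedProd c) := ⟨fun x => ⟨-x.fst - c x.snd⁻¹ x.snd - c 1 1, x.snd⁻¹⟩⟩

lemma mul_def (x y : TwistedProd c) :
    x * y = ⟨x.fst + y.fst + c x.snd y.snd, x.snd * y.snd⟩ := rfl

lemma one_def : (1 : TwistedProd c) = ⟨-c 1 1, 1⟩ := rfl

lemma inv_def (x : TwistedProd c) : x⁻¹ = ⟨-x.fst - c x.snd⁻¹ x.snd - c 1 1, x.snd⁻¹⟩ := rfl

/-- With `cocycle_one_right`, this is what makes the shifted unit neutral and the kernel central. -/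
lemma cocycle_one_left (hc : ∀ g h k, c h k + c g (h * k) = c (g * h) k + c g h) (g : G) :
    c 1 g = c 1 1 := by
  simpa using hc 1 1 g

lemma cocycle_one_right (hc : ∀ g h k, c h k + c g (h * k) = c (g * h) k + c g h) (g : G) :
    c g 1 = c 1 1 := by
  simpa using (hc g 1 1).symm

/-- The group structure defined by a cocycle. -/
abbrev group (hc : ∀ g h k, c h k + c g (h * k) = c (g * h) k + c g h) :
    Group (TwistedProd c) :=
  Group.ofLeftAxioms
    (fun x y z => TwistedProd.ext
      (by
        have := eq_sub_of_add_eq (hc x.snd y.snd z.snd).symm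
        simp only [mul_def, this]
        abel)
      (mul_assoc _ _ _))
    (fun x => TwistedProd.ext
      (by
        simp only [mul_def, one_def, cocycle_one_left hc]
        abel)
      (one_mul _))
    (fun x => TwistedProd.ext
      (by
        simp only [mul_def, inv_def, one_def]
        abel)
      (inv_mul_cancel _))

end TwistedProd

namespace CentralFExt

variable {Γ : Type u} {G : Type v} [Group Γ] [Group G] {f : Γ →* G} {A : Type w} [AddCommGroup A]

lemma exists_isCochain_of_cocycle (c : G → G → A) (b : Γ → A)
    (hc : ∀ g h k, c h k + c g (h * k) = c (g * h) k + c g h)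
    (hb : ∀ γ δ, b (γ * δ) = b γ + b δ + c (f γ) (f δ)) :
    ∃ (E : CentralFExt f A) (s : G → E.M), (∀ g, E.π (s g) = g) ∧
      (∀ g h, s g * s h = E.ι (c g h) * s (g * h)) ∧ ∀ γ, E.ψ γ = E.ι (b γ) * s (f γ) := by
  let _ := TwistedProd.group hc
  have h1 := TwistedProd.cocycle_one_left hc
  have h2 := TwistedProd.cocycle_one_right hc
  -- The shift by `c 1 1` sends `0` to the unit `(-c 1 1, 1)`.
  let i : Multiplicative A →* TwistedProd c :=
    MonoidHom.mk' (fun a => ⟨a.toAdd - c 1 1, 1⟩) fun a a' => TwistedProd.ext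
      (by simp only [TwistedProd.mul_def, toAdd_mul]; abel) (one_mul _).symm
  let p : TwistedProd c →* G := MonoidHom.mk' TwistedProd.snd fun _ _ => rfl
  let ψ : Γ →* TwistedProd c := MonoidHom.mk' (fun γ => ⟨b γ, f γ⟩) fun γ δ =>
    TwistedProd.ext (hb γ δ) (map_mul f γ δ)
  -- The section `g ↦ (0, g)` has factor set exactly `c`, with no normalization needed.
  refine ⟨ofMaps (TwistedProd c) i p ψ ?_ ?_ ?_ ?_ ?_ ?_, fun g => ⟨0, g⟩, ?_, ?_, ?_⟩
  · intro a a' h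
    exact Multiplicative.toAdd.injective (sub_left_injective (congrArg TwistedProd.fst h))
  · exact fun g => ⟨⟨0, g⟩, rfl⟩
  · exact fun _ => rfl
  · rintro ⟨a, g⟩ hg
    obtain rfl : g = 1 := hg
    exact ⟨Multiplicative.ofAdd (a + c 1 1), TwistedProd.ext (add_sub_cancel_right _ _) rfl⟩
  · intro a x
    refine TwistedProd.ext ?_ ((one_mul _).trans (mul_one _).symm)
    change a.toAdd - c 1 1 + x.fst + c 1 x.snd = x.fst + (a.toAdd - c 1 1) + c x.snd 1
    rw [h1 x.snd, h2 x.snd]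
    abel
  · exact fun _ => rfl
  · exact fun _ => rfl
  · intro g h
    refine TwistedProd.ext ?_ (one_mul _).symm
    change 0 + 0 + c g h = c g h - c 1 1 + 0 + c 1 (g * h)
    rw [h1 (g * h)]
    abel
  · intro γ
    refine TwistedProd.ext ?_ (one_mul _).symm
    change b γ = b γ - c 1 1 + 0 + c 1 (f γ)
    rw [h1 (f γ)]
    abel

/-- Every relative cocycle comes from a central `f`-extension. -/
lemma exists_isCochain_of_apply_relD {φ : (Bar G 2 × Bar Γ 1) →ₗ[ℤ] A}
    (hφ : ∀ z, φ (relD f 1 z) = 0) : ∃ (E : CentralFExt f A) (s : G → E.M), E.IsCochain s φ := by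
  have hx : ∀ x : Bar G 2, φ (x, 0) = φ.comp (LinearMap.inl ℤ _ _) x := fun _ => rfl
  have hy : ∀ y : Bar Γ 1, φ (0, y) = φ.comp (LinearMap.inr ℤ _ _) y := fun _ => rfl
  have split : ∀ (x : Bar G 2) (y : Bar Γ 1), φ (x, y) = φ (x, 0) + φ (0, y) := fun x y => by
    rw [← map_add]; simp
  obtain ⟨E, s, h1, h2, h3⟩ := exists_isCochain_of_cocycle (f := f)
    (fun g h => φ (single ![g, h] 1, 0)) (fun γ => φ (0, single ![γ] 1))
    -- Vanishing on the boundary of `[g|h|k]` is the cocycle identity; vanishing on that of `[γ|δ]`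
    -- makes `γ ↦ (b γ, f γ)` multiplicative.
    (fun g h k => by
      have := hφ (single ![g, h, k] 1, 0)
      rw [relD_inl_single] at this
      simp only [hx, map_add, map_sub] at this ⊢
      rw [← sub_eq_zero, ← this]
      abel)
    (fun γ δ => by
      have := hφ (0, single ![γ, δ] 1)
      rw [relD_inr_single, split] at this
      simp only [hx, hy, map_add, map_sub, map_neg] at this ⊢
      rw [← sub_eq_zero, ← this]
      abel)
  exact ⟨E, s, h1, h2, h3⟩

end CentralFExt

/-! ### The comparison homomorphism and its bijectivity -/

namespace Ext

open CentralFExt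

variable {Γ : Type u} {G : Type v} [Group Γ] [Group G] {f : Γ →* G}
variable {A : Type w} [AddCommGroup A] {B : Type w} [AddCommGroup B]

/-- An equivalence carries a section of one representative to a section of the other with the same
cochain, and `eq_on_ker` compares sections of a single extension. Quantifying over all choices lets
`homologyHom_mk` compute with any convenient cochain. -/
lemma exists_homologyHom (x : Ext f A) : ∃ ℓ : H2 f →+ A, ∀ (E : CentralFExt f A) (s : G → E.M)
    (φ : (Bar G 2 × Bar Γ 1) →ₗ[ℤ] A) (h : E.IsCochain s φ), mk E = x → h.homologyHom = ℓ := by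
  obtain ⟨E, rfl⟩ : ∃ E, mk E = x := Quotient.exists_rep x
  obtain ⟨s, φ, h⟩ := E.exists_isCochain
  refine ⟨h.homologyHom, fun E' s' φ' h' hE => ?_⟩
  obtain ⟨t⟩ := Quotient.exact hE
  exact h'.homologyHom_eq_iff.2 fun z => (h'.map t).eq_on_ker h z.2

/-- The homomorphism `H₂(G, Γ) → A` defined by a class in `Ext^Γ(G; A)`. -/
noncomputable def homologyHom (x : Ext f A) : H2 f →+ A := x.exists_homologyHom.choose

lemma homologyHom_mk {E : CentralFExt f A} {s : G → E.M} {φ : (Bar G 2 × Bar Γ 1) →ₗ[ℤ] A}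
    (h : E.IsCochain s φ) : (mk E).homologyHom = h.homologyHom :=
  ((mk E).exists_homologyHom.choose_spec E s φ h rfl).symm

lemma homologyHom_push (κ : A →+ B) (x : Ext f A) :
    (push κ x).homologyHom = κ.comp x.homologyHom := by
  obtain ⟨E, rfl⟩ : ∃ E, mk E = x := Quotient.exists_rep x
  obtain ⟨s, φ, h⟩ := E.exists_isCochain
  rw [push_mk_eq (E.toPush κ), homologyHom_mk (h.map (E.toPush κ)), homologyHom_mk h,
    IsCochain.homologyHom_eq_iff]
  exact fun _ => rfl

lemma homologyHom_pull {Γ' : Type u} {G' : Type v} [Group Γ'] [Group G'] {f' : Γ' →* G'}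
    {α : Γ' →* Γ} {β : G' →* G} (hsq : β.comp f' = f.comp α) (x : Ext f A) :
    (pull hsq x).homologyHom = x.homologyHom.comp (H2.map hsq) := by
  obtain ⟨E, rfl⟩ : ∃ E, mk E = x := Quotient.exists_rep x
  obtain ⟨s, φ, h⟩ := E.exists_isCochain
  rw [homologyHom_mk h]
  exact (homologyHom_mk (h.pull hsq)).trans ((h.pull hsq).homologyHom_eq_iff.2 fun _ => rfl)

/-- The fibre product has cochain `(φ, φ')`, and pushing out along addition turns it into `φ + φ'`.
-/
lemma homologyHom_add (x y : Ext f A) :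
    (x + y).homologyHom = x.homologyHom + y.homologyHom := by
  obtain ⟨E, rfl⟩ : ∃ E, mk E = x := Quotient.exists_rep x
  obtain ⟨E', rfl⟩ : ∃ E, mk E = y := Quotient.exists_rep y
  obtain ⟨s, φ, h⟩ := E.exists_isCochain
  obtain ⟨s', φ', h'⟩ := E'.exists_isCochain
  rw [mk_add_mk, homologyHom_push, homologyHom_mk (h.prod h'), homologyHom_mk h,
    homologyHom_mk h']
  refine AddMonoidHom.ext fun z => ?_
  obtain ⟨z, rfl⟩ := Submodule.Quotient.mk_surjective _ z
  rfl

lemma homologyHom_injective (hf : Function.Surjective (Abelianization.map f)) :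
    Function.Injective (homologyHom : Ext f A → H2 f →+ A) := by
  refine (injective_iff_map_eq_zero (AddMonoidHom.mk' _ homologyHom_add)).2 fun x hx => ?_
  obtain ⟨E, rfl⟩ : ∃ E, mk E = x := Quotient.exists_rep x
  obtain ⟨s, φ, h⟩ := E.exists_isCochain
  obtain ⟨σ, hσ⟩ := boundary_exists_section f hf
  have hker := h.homologyHom_eq_iff.1 ((homologyHom_mk h).symm.trans hx)
  -- Since `φ` vanishes on the cycle `z - σ (boundary f z)`, it equals `φ ∘ σ ∘ boundary f`; this
  -- change of section therefore kills the cochain and splits the extension.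
  have h0 := h.twist (-(φ.comp σ))
  have hφ : φ + (-(φ.comp σ)).comp (boundary f) = 0 := by
    refine LinearMap.ext fun z => ?_
    have := hker ⟨z - σ (boundary f z), (boundary_eq_zero_iff f).1 (by rw [map_sub, hσ, sub_self])⟩
    rw [AddMonoidHom.zero_apply, map_sub] at this
    rw [LinearMap.zero_apply, ← this, sub_eq_add_neg]
    rfl
  rw [hφ] at h0
  exact (mk_eq h0.ofTrivial).symm

lemma homologyHom_surjective (hf : Function.Surjective (Abelianization.map f)) :
    Function.Surjective (homologyHom : Ext f A → H2 f →+ A) := by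
  intro ℓ
  obtain ⟨σ, hσ⟩ := boundary_exists_section f hf
  -- A retraction of chains onto cycles, along which `ℓ` extends to a cochain. The extension kills
  -- boundaries because boundaries are cycles representing zero in `H2 f`.
  let r : (Bar G 2 × Bar Γ 1) →ₗ[ℤ] LinearMap.ker (relD f 0) :=
    (LinearMap.id - σ.comp (boundary f)).codRestrict _ fun z =>
      (boundary_eq_zero_iff f).1 (by simp [hσ])
  have hr : ∀ z : LinearMap.ker (relD f 0), r z = z := fun z => Subtype.ext (by
    simp [r, (boundary_eq_zero_iff f).2 z.2])
  let φ : (Bar G 2 × Bar Γ 1) →ₗ[ℤ] A :=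
    ℓ.toIntLinearMap.comp ((Submodule.mkQ _).comp r)
  have hφ : ∀ z : LinearMap.ker (relD f 0), φ z = ℓ (Submodule.Quotient.mk z) := fun z =>
    congrArg (fun y => ℓ (Submodule.Quotient.mk y)) (hr z)
  obtain ⟨E, s, h⟩ := exists_isCochain_of_apply_relD (f := f) (φ := φ) fun z => by
    refine (hφ ⟨relD f 1 z, relD_relD f 0 z⟩).trans ?_
    exact (congrArg ℓ ((Submodule.Quotient.mk_eq_zero _).2
      (LinearMap.mem_range_self (relD f 1) z))).trans (map_zero ℓ)
  exact ⟨mk E, (homologyHom_mk h).trans (h.homologyHom_eq_iff.2 hφ)⟩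

/-- The isomorphism `Ext^Γ(G; A) ≅ Hom(H₂(G, Γ), A)`. -/
noncomputable def homologyEquiv (hf : Function.Surjective (Abelianization.map f))
    (A : Type w) [AddCommGroup A] : Ext f A ≃+ (H2 f →+ A) :=
  AddEquiv.ofBijective (AddMonoidHom.mk' homologyHom homologyHom_add)
    ⟨homologyHom_injective hf, homologyHom_surjective hf⟩

end Ext

end RelSchur

/-- If `f : Γ → G` is surjective on abelianizations, then `Ext^Γ(G; A) ≅ Hom(H₂(G, Γ), A)` as
abelian groups, naturally in the abelian group `A` and in `f`. -/
theorem corollary2p7 :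
    ∃ Φ : ∀ (Γ : Type u) (G : Type v) [Group Γ] [Group G] (f : Γ →* G),
        Function.Surjective (Abelianization.map f) → ∀ (A : Type w) [AddCommGroup A],
          RelSchur.Ext f A ≃+ (RelSchur.H2 f →+ A),
      (∀ (Γ : Type u) (G : Type v) [Group Γ] [Group G] (f : Γ →* G)
        (hf : Function.Surjective (Abelianization.map f))
        (A B : Type w) [AddCommGroup A] [AddCommGroup B] (κ : A →+ B) (x : RelSchur.Ext f A),
          Φ Γ G f hf B (RelSchur.Ext.push κ x) = κ.comp (Φ Γ G f hf A x)) ∧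
      (∀ (Γ Γ' : Type u) (G G' : Type v) [Group Γ] [Group Γ'] [Group G] [Group G']
        (f : Γ →* G) (f' : Γ' →* G')
        (hf : Function.Surjective (Abelianization.map f))
        (hf' : Function.Surjective (Abelianization.map f'))
        (α : Γ' →* Γ) (β : G' →* G) (h : β.comp f' = f.comp α)
        (A : Type w) [AddCommGroup A] (x : RelSchur.Ext f A),
          Φ Γ' G' f' hf' A (RelSchur.Ext.pull h x) =
            (Φ Γ G f hf A x).comp (RelSchur.H2.map h)) :=
  ⟨fun _ _ _ _ _ hf A _ => RelSchur.Ext.homologyEquiv hf A,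
    fun _ _ _ _ _ _ _ _ _ _ κ x => RelSchur.Ext.homologyHom_push κ x,
    fun _ _ _ _ _ _ _ _ _ _ _ _ _ _ h _ _ x => RelSchur.Ext.homologyHom_pull h x⟩
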